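/- Conventions. All spaces are diffeological spaces. A diffeological vector pseudo-bundle is a smooth surjection $\pi:V\to X$ whose fibres are real vector spaces, such that the fibrewise addition $V\times_XV\to V$, the scalar multiplication $\mathbb R\times V\to V$ and the zero section $X\to V$ are smooth. It is locally trivial if every point of $X$ has a D-open neighbourhood $U$ with a fibrewise linear diffeomorphism $\pi^{-1}(U)\cong U\times F$ over $U$, for some diffeological vector space $F$. The dual pseudo-bundle $\pi^*:V^*\to X$ has as fibre over $x$ the space $(\pi^{-1}(x))^*$ of smooth linear maps $\pi^{-1}(x)\to\mathbb R$; a map $q$ into $V^*$ is a plot if $\pi^*\circ q$ is a plot of $X$ and, for every plot $p$ of $V$, the evaluation $(s,t)\mapsto q(s)(p(t))$ is smooth on $\{(s,t):\pi^*(q(s))=\pi(p(t))\}$ with the subset diffeology. A pseudo-metric on a pseudo-bundle $V$ with finite-dimensional fibres is a smooth section $g$ of $V^*\otimes V^*$ such that each $g(x)$ is a smooth symmetric positive semi-definite bilinear form on $\pi^{-1}(x)$ of rank $\dim(\pi^{-1}(x))^*$. It induces on $V^*$ the forms $g^*$ determined by $g^*(x)\big(g(x)(v,\cdot),g(x)(w,\cdot)\big)=g(x)(v,w)$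 for $v,w\in\pi^{-1}(x)$. A gluing of $\pi_1:V_1\to X_1$ to $\pi_2:V_2\to X_2$ is a pair $(\tilde f,f)$ consisting of a smooth map $f:Y\to X_2$ on a subset $Y\subseteq X_1$ (with the subset diffeology) and a smooth fibrewise linear lift $\tilde f:\pi_1^{-1}(Y)\to V_2$ of $f$. Pseudo-metrics $g_1,g_2$ on $V_1,V_2$ are compatible with the gluing along $(\tilde f,f)$ if $g_1(y)(v,w)=g_2(f(y))(\tilde f(v),\tilde f(w))$ for all $y\in Y$ and $v,w\in\pi_1^{-1}(y)$. The spaces $X_1\cup_fX_2$ and $V_1\cup_{\tilde f}V_2$ are the quotients of the disjoint unions obtained by identifying $y$ with $f(y)$, respectively $v$ with $\tilde f(v)$, with the quotient diffeology; $i_1,j_1$ denote the natural inclusions of $X_1\setminus Y$, $V_1\setminus\pi_1^{-1}(Y)$, and $i_2,j_2$ those of $X_2$, $V_2$, with a superscript naming the space that is included. When $f$ is a diffeomorphism onto its image, $\tilde f^*$ (given by $\varphi\mapsto\varphi\circ\tilde f$) and $f^{-1}$ define a gluing of $V_2^*$ to $V_1^*$. The gluing-dual commutativity condition for $V_1$,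 $V_2$, $(\tilde f,f)$ says that $f$ is a diffeomorphism onto its image and that there is a diffeomorphism $\Phi_{\cup,*}:(V_1\cup_{\tilde f}V_2)^*\to V_2^*\cup_{\tilde f^*}V_1^*$ which covers the switch map $X_1\cup_fX_2\to X_2\cup_{f^{-1}}X_1$ and equals $j_2^{V_1^*}\circ(j_1^{V_1})^*$ over $i_1(X_1\setminus Y)$, $j_2^{V_1^*}\circ\tilde f^*\circ(j_2^{V_2})^*$ over $i_2(f(Y))$, and $j_1^{V_2^*}\circ(j_2^{V_2})^*$ over $i_2(X_2\setminus f(Y))$. Theorem. Let $\pi_1:V_1\to X_1$ and $\pi_2:V_2\to X_2$ be locally trivial diffeological vector pseudo-bundles with finite-dimensional fibres, let $(\tilde f,f)$ be a gluing of $V_1$ to $V_2$, and let $g_1$, $g_2$ be pseudo-metrics on $V_1$, $V_2$ compatible with this gluing. Assume that $V_1$, $V_2$ and $(\tilde f,f)$ satisfy the gluing-dual commutativity condition. Then the induced pseudo-metrics $g_2^*$ and $g_1^*$ are compatible with the gluing of $V_2^*$ to $V_1^*$ along $(\tilde f^*,f^{-1})$, that is, $$g_2^*(y')(\varphi,\psi)=g_1^*(f^{-1}(y'))\big(\tilde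 f^*(\varphi),\tilde f^*(\psi)\big)\qquad\text{for all }y'\in f(Y),\ \varphi,\psi\in(\pi_2^{-1}(y'))^*.$$ -/

import Mathlib

open Diffeology Filter Topology Function
open scoped ContDiff TensorProduct

universe u u₁ u₂ v

/-! ## Diffeologies: subsets, products, disjoint unions, pushforwards -/

/-- The standard `ℝⁿ`. -/
abbrev Euc (n : ℕ) : Type := EuclideanSpace ℝ (Fin n)

namespace Diffeo

/-- Every open set contains the range of a smooth map which is the identity near a given point. -/
theorem exists_localizer {n : ℕ} {s : Set (Euc n)} (hs : IsOpen s) {x : Euc n} (hx : x ∈ s) :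
    ∃ ρ : Euc n → Euc n, ContDiff ℝ ∞ ρ ∧ (∀ y, ρ y ∈ s) ∧ ∀ᶠ y in 𝓝 x, ρ y = y := by
  obtain ⟨ε, hε, hball⟩ := Metric.isOpen_iff.mp hs x hx
  let χ : ContDiffBump x := ⟨ε / 2, ε, by positivity, by linarith⟩
  refine ⟨fun y => x + χ y • (y - x), ?_, ?_, ?_⟩
  · exact contDiff_const.add (χ.contDiff.smul (contDiff_id.sub contDiff_const))
  · intro y
    apply hball
    rw [Metric.mem_ball, dist_eq_norm, add_sub_cancel_left, norm_smul, Real.norm_eq_abs,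
      abs_of_nonneg χ.nonneg]
    by_cases hy : dist y x < ε
    · calc χ y * ‖y - x‖ ≤ 1 * ‖y - x‖ := by gcongr; exact χ.le_one
        _ < ε := by rw [one_mul, ← dist_eq_norm]; exact hy
    · rw [χ.zero_of_le_dist (not_lt.mp hy), zero_mul]; exact hε
  · filter_upwards [χ.eventuallyEq_one] with y hy
    rw [hy]; simp

/-- The pullback diffeology: `p` is a plot iff `f ∘ p` is. For injective `f` this is the subset
diffeology. -/
@[reducible]
def induced {X Y : Type*} (f : X → Y) (_ : DiffeologicalSpace Y) : DiffeologicalSpace X where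
  plots _ := {p | IsPlot (f ∘ p)}
  constant_plots x := isPlot_const (x := f x)
  plot_reparam {n m p g} hp hg := isPlot_reparam (p := f ∘ p) (f := g) hp hg
  locality {n p} h := DiffeologicalSpace.locality (p := f ∘ p) h

/-- The diffeology whose plots are locally members of `gen`. -/
@[reducible]
def locallyOf {X : Type*} (gen : ∀ n : ℕ, Set (Euc n → X))
    (hc : ∀ (n : ℕ) (x : X), (fun _ => x) ∈ gen n)
    (hr : ∀ (n m : ℕ) (p : Euc m → X) (f : Euc n → Euc m),
      p ∈ gen m → ContDiff ℝ ∞ f → p ∘ f ∈ gen n) : DiffeologicalSpace X where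
  plots n := {p | ∀ x, ∃ q ∈ gen n, p =ᶠ[𝓝 x] q}
  constant_plots {n} x := fun _ => ⟨_, hc n x, EventuallyEq.rfl⟩
  plot_reparam {n m p f} hp hf := fun x => by
    obtain ⟨q, hq, he⟩ := hp (f x)
    exact ⟨q ∘ f, hr _ _ _ _ hq hf, hf.continuous.continuousAt.eventually he⟩
  locality {n p} h := fun x => by
    obtain ⟨s, hs, hx, h'⟩ := h x
    obtain ⟨ρ, hρ, hρs, hρx⟩ := exists_localizer hs hx
    obtain ⟨q, hq, he⟩ := h' hρs hρ x
    refine ⟨q, hq, ?_⟩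
    filter_upwards [he, hρx] with y hy hy'
    rw [← hy, comp_apply, hy']

/-- The pushforward (quotient) diffeology along a surjection: plots are locally of the form
`f ∘ q` with `q` a plot. -/
@[reducible]
def coinduced {X Y : Type*} [DiffeologicalSpace X] (f : X → Y) (hf : Surjective f) :
    DiffeologicalSpace Y :=
  locallyOf (fun n => {p | ∃ q : Euc n → X, IsPlot q ∧ p = f ∘ q})
    (fun n y => by
      obtain ⟨x, rfl⟩ := hf y
      exact ⟨fun _ => x, isPlot_const, rfl⟩)
    (by
      rintro n m _ g ⟨q, hq, rfl⟩ hg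
      exact ⟨q ∘ g, isPlot_reparam hq hg, rfl⟩)

/-- The subset diffeology. -/
instance instSubtype {X : Type*} [d : DiffeologicalSpace X] (P : X → Prop) :
    DiffeologicalSpace {x // P x} := induced Subtype.val d

/-- The product diffeology. -/
instance instProd {X Y : Type*} [d : DiffeologicalSpace X] [e : DiffeologicalSpace Y] :
    DiffeologicalSpace (X × Y) := induced Prod.fst d ⊓ induced Prod.snd e

/-- The disjoint union diffeology: locally, a plot is a plot of one of the two terms. -/
instance instSum {X Y : Type*} [DiffeologicalSpace X] [DiffeologicalSpace Y] :
    DiffeologicalSpace (X ⊕ Y) :=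
  locallyOf (fun n => {p | (∃ q : Euc n → X, IsPlot q ∧ p = Sum.inl ∘ q) ∨
      ∃ q : Euc n → Y, IsPlot q ∧ p = Sum.inr ∘ q})
    (fun n z => by
      rcases z with x | y
      · exact Or.inl ⟨fun _ => x, isPlot_const, rfl⟩
      · exact Or.inr ⟨fun _ => y, isPlot_const, rfl⟩)
    (by
      rintro n m _ g (⟨q, hq, rfl⟩ | ⟨q, hq, rfl⟩) hg
      · exact Or.inl ⟨q ∘ g, isPlot_reparam hq hg, rfl⟩
      · exact Or.inr ⟨q ∘ g, isPlot_reparam hq hg, rfl⟩)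

theorem isPlot_prod {X Y : Type*} [DiffeologicalSpace X] [DiffeologicalSpace Y] {n : ℕ}
    {p : Euc n → X × Y} :
    IsPlot p ↔ IsPlot (fun t => (p t).1) ∧ IsPlot (fun t => (p t).2) :=
  DiffeologicalSpace.isPlot_inf_iff

theorem isPlot_coinduced_sum {X Y Z : Type*} [DiffeologicalSpace X] [DiffeologicalSpace Y]
    {f : X ⊕ Y → Z} {hf : Surjective f} {n : ℕ} {p : Euc n → Z} :
    @IsPlot Z (coinduced f hf) n p ↔ ∀ t₀,
      (∃ q : Euc n → X, IsPlot q ∧ p =ᶠ[𝓝 t₀] fun t => f (Sum.inl (q t))) ∨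
      ∃ q : Euc n → Y, IsPlot q ∧ p =ᶠ[𝓝 t₀] fun t => f (Sum.inr (q t)) := by
  constructor
  · intro hp t₀
    obtain ⟨_, ⟨q, hq, rfl⟩, he⟩ := hp t₀
    obtain ⟨_, ⟨r, hr, rfl⟩ | ⟨r, hr, rfl⟩, he'⟩ := hq t₀
    · exact Or.inl ⟨r, hr, he.trans (he'.fun_comp f)⟩
    · exact Or.inr ⟨r, hr, he.trans (he'.fun_comp f)⟩
  · intro h t₀
    rcases h t₀ with ⟨q, hq, he⟩ | ⟨q, hq, he⟩
    · exact ⟨_, ⟨Sum.inl ∘ q, fun _ => ⟨_, Or.inl ⟨q, hq, rfl⟩, EventuallyEq.rfl⟩, rfl⟩, he⟩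
    · exact ⟨_, ⟨Sum.inr ∘ q, fun _ => ⟨_, Or.inr ⟨q, hq, rfl⟩, EventuallyEq.rfl⟩, rfl⟩, he⟩

theorem isPlot_subtype {X : Type*} [DiffeologicalSpace X] {P : X → Prop} {n : ℕ}
    {p : Euc n → {x // P x}} : IsPlot p ↔ IsPlot (fun t => (p t).1) := Iff.rfl

end Diffeo

open Diffeo

/-! ## Diffeological vector spaces: the smooth dual and pseudo-metrics -/

/-- The underlying vector space of the diffeological dual: all smooth linear maps `V → ℝ`. -/
def SmoothDual (V : Type*) [AddCommGroup V] [Module ℝ V] [DiffeologicalSpace V] :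
    Submodule ℝ (V →ₗ[ℝ] ℝ) where
  carrier := {φ | DSmooth (φ : V → ℝ)}
  add_mem' ha hb := fun n p hp => ((ha n p hp).contDiff.add (hb n p hp).contDiff).isPlot
  zero_mem' := dSmooth_const (y := (0 : ℝ))
  smul_mem' _ _ ha := fun n p hp => (contDiff_const.smul (ha n p hp).contDiff).isPlot

/-- The dual map `L* : W* → V*`, `φ ↦ φ ∘ L`, of a smooth linear map `L : V → W`. -/
def SmoothDual.comap {V W : Type*} [AddCommGroup V] [Module ℝ V] [DiffeologicalSpace V]
    [AddCommGroup W] [Module ℝ W] [DiffeologicalSpace W] (L : V →ₗ[ℝ] W) (hL : DSmooth L) :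
    SmoothDual W →ₗ[ℝ] SmoothDual V where
  toFun φ := ⟨φ.1 ∘ₗ L, fun n p hp => φ.2 n (L ∘ p) (hL n p hp)⟩
  map_add' _ _ := rfl
  map_smul' _ _ := rfl

/-- A pseudo-metric on a diffeological vector space: a smooth symmetric positive semi-definite
bilinear form whose rank is the dimension of the diffeological dual. -/
structure IsVectorPseudoMetric {V : Type*} [AddCommGroup V] [Module ℝ V] [DiffeologicalSpace V]
    (b : LinearMap.BilinForm ℝ V) : Prop where
  smooth : DSmooth (fun z : V × V => b z.1 z.2)
  symm : ∀ v w, b v w = b w v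
  nonneg : ∀ v, 0 ≤ b v v
  rank_eq : Module.finrank ℝ (LinearMap.range b) = Module.finrank ℝ (SmoothDual V)

section InducedForm

variable {V : Type*} [AddCommGroup V] [Module ℝ V] [DiffeologicalSpace V]
  {b : LinearMap.BilinForm ℝ V}

/-- The natural pairing map `v ↦ b(v, ·)` into the diffeological dual. -/
def IsVectorPseudoMetric.pairing (hb : IsVectorPseudoMetric b) : V →ₗ[ℝ] SmoothDual V :=
  LinearMap.codRestrict (SmoothDual V) b fun v n p hp =>
    hb.smooth n (fun t => (v, p t)) (isPlot_prod.2 ⟨isPlot_const, hp⟩)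

theorem IsVectorPseudoMetric.exists_section [FiniteDimensional ℝ V]
    (hb : IsVectorPseudoMetric b) :
    ∃ s : SmoothDual V →ₗ[ℝ] V, hb.pairing ∘ₗ s = LinearMap.id := by
  have : Module.Free ℝ (SmoothDual V) := Module.Free.of_divisionRing ℝ (SmoothDual V)
  have : Module.Projective ℝ (SmoothDual V) := Module.Projective.of_free
  refine LinearMap.exists_rightInverse_of_surjective hb.pairing ?_
  refine Submodule.eq_top_of_finrank_eq (K := ℝ) (V := SmoothDual V) ?_
  rw [← hb.rank_eq]
  have h : LinearMap.range b = (LinearMap.range hb.pairing).map (SmoothDual V).subtype := by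
    rw [← LinearMap.range_comp]; rfl
  rw [h]
  exact (LinearEquiv.finrank_eq (Submodule.equivMapOfInjective (SmoothDual V).subtype
    (Submodule.injective_subtype _) (LinearMap.range hb.pairing)))

/-- The induced form `b*` on the diffeological dual: `b*(φ, ψ) = b(v, w)` for any `v`, `w` with
`φ = b(v, ·)` and `ψ = b(w, ·)`, see `dualForm_pairing`. It is written here with a linear right
inverse of the pairing map. -/
noncomputable def IsVectorPseudoMetric.dualForm [FiniteDimensional ℝ V]
    (hb : IsVectorPseudoMetric b) : LinearMap.BilinForm ℝ (SmoothDual V) :=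
  b.compl₁₂ hb.exists_section.choose hb.exists_section.choose

/-- The defining equality `b*(b(v, ·), b(w, ·)) = b(v, w)`. -/
theorem IsVectorPseudoMetric.dualForm_pairing [FiniteDimensional ℝ V]
    (hb : IsVectorPseudoMetric b) (v w : V) :
    hb.dualForm (hb.pairing v) (hb.pairing w) = b v w := by
  have hs : ∀ φ, hb.pairing (hb.exists_section.choose φ) = φ :=
    LinearMap.congr_fun hb.exists_section.choose_spec
  have key : ∀ v z, b (hb.exists_section.choose (hb.pairing v)) z = b v z := fun v z =>
    LinearMap.congr_fun (congrArg Subtype.val (hs (hb.pairing v))) z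
  unfold IsVectorPseudoMetric.dualForm
  rw [LinearMap.compl₁₂_apply, key, hb.symm, key, hb.symm]

end InducedForm

/-! ## Diffeological vector pseudo-bundles -/

/-- The three smoothness axioms of a diffeological vector pseudo-bundle, together with smoothness of
the projection, for a diffeology `d` on the total space `Σ x, E x` of a family of vector spaces. The
fibre product `V ×_X V` is `Σ x, E x × E x`, with the subset diffeology of `V × V`. -/
structure IsBundleDiffeology {X : Type u} [DiffeologicalSpace X] (E : X → Type v)
    [∀ x, AddCommGroup (E x)] [∀ x, Module ℝ (E x)] (d : DiffeologicalSpace (Σ x, E x)) :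
    Prop where
  smooth_proj : DSmooth (Sigma.fst : (Σ x, E x) → X)
  smooth_add : @DSmooth (Σ x, E x × E x) (Σ x, E x)
    (induced (fun z => ((⟨z.1, z.2.1⟩, ⟨z.1, z.2.2⟩) : (Σ x, E x) × (Σ x, E x))) inferInstance) d
    (fun z => ⟨z.1, z.2.1 + z.2.2⟩)
  smooth_smul : DSmooth (fun z : ℝ × (Σ x, E x) => (⟨z.2.1, z.1 • z.2.2⟩ : Σ x, E x))
  smooth_zero : DSmooth (fun x : X => (⟨x, 0⟩ : Σ x, E x))

/-- A diffeological vector pseudo-bundle over `X`, given by its family of fibres and the diffeology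
of its total space. -/
structure PseudoBundle (X : Type u) [DiffeologicalSpace X] where
  Fib : X → Type v
  [group : ∀ x, AddCommGroup (Fib x)]
  [module : ∀ x, Module ℝ (Fib x)]
  [diffeology : DiffeologicalSpace (Σ x, Fib x)]
  isBundle : IsBundleDiffeology Fib diffeology

namespace PseudoBundle

attribute [instance] group module

section Basic

variable {X : Type u} [DiffeologicalSpace X] (V : PseudoBundle.{u, v} X)

/-- The total space. -/
abbrev Total : Type (max u v) := Σ x, V.Fib x

instance : DiffeologicalSpace (Σ x, V.Fib x) := V.diffeology

/-- The subset diffeology on a fibre. -/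
instance (x : X) : DiffeologicalSpace (V.Fib x) :=
  induced (fun w => (⟨x, w⟩ : V.Total)) inferInstance

/-- The identification of fibres over equal points. -/
def castFib {x y : X} (h : x = y) : V.Fib x ≃ₗ[ℝ] V.Fib y := h ▸ LinearEquiv.refl ℝ (V.Fib x)

/-- Finite-dimensional fibres. -/
def FiniteDim : Prop := ∀ x, FiniteDimensional ℝ (V.Fib x)

/-- Local triviality: every point has a D-open neighbourhood `U` over which there is a fibrewise
linear diffeomorphism `π⁻¹(U) ≅ U × F` covering the identity, `F` being the fibre at the point. -/
def LocallyTrivial : Prop :=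
  ∀ x₀ : X, ∃ U : Set X, IsOpen[dTopology] U ∧ x₀ ∈ U ∧
    ∃ e : ∀ x : U, V.Fib x ≃ₗ[ℝ] V.Fib x₀,
      DSmooth (fun w : {w : V.Total // w.1 ∈ U} =>
        ((⟨w.1.1, w.2⟩, e ⟨w.1.1, w.2⟩ w.1.2) : U × V.Fib x₀)) ∧
      DSmooth (fun z : U × V.Fib x₀ =>
        (⟨⟨z.1, (e z.1).symm z.2⟩, z.1.2⟩ : {w : V.Total // w.1 ∈ U}))

/-- The sum of two elements of a family of vector spaces over the same base point. -/
def sigmaAdd {X : Type*} {E : X → Type*} [∀ x, AddCommGroup (E x)] (z w : Σ x, E x)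
    (h : z.1 = w.1) : Σ x, E x := ⟨z.1, z.2 + h ▸ w.2⟩

theorem sigmaAdd_congr {X : Type*} {E : X → Type*} [∀ x, AddCommGroup (E x)]
    {z w z' w' : Σ x, E x} (hz : z = z') (hw : w = w') (h : z.1 = w.1) (h' : z'.1 = w'.1) :
    sigmaAdd z w h = sigmaAdd z' w' h' := by
  subst hz hw; rfl

variable {V} in
theorem isPlot_sigmaAdd {n : ℕ} {p q : Euc n → Σ x, V.Fib x} (hp : IsPlot p) (hq : IsPlot q)
    (h : ∀ t, (p t).1 = (q t).1) : IsPlot (fun t => sigmaAdd (p t) (q t) (h t)) := by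
  refine V.isBundle.smooth_add n (fun t => ⟨(p t).1, ((p t).2, (h t) ▸ (q t).2)⟩)
    (isPlot_prod.2 ⟨hp, ?_⟩)
  have aux : ∀ (x : X) (w : V.Total) (hw : x = w.1), (⟨x, hw ▸ w.2⟩ : V.Total) = w := by
    rintro _ ⟨x, w⟩ ⟨⟩; rfl
  have : (fun t => (⟨(p t).1, (h t) ▸ (q t).2⟩ : V.Total)) = q := funext fun t => aux _ _ (h t)
  change IsPlot (fun t => (⟨(p t).1, (h t) ▸ (q t).2⟩ : V.Total))
  rw [this]; exact hq

end Basic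

/-! ### The dual pseudo-bundle -/

section Dual

variable {X : Type u} [DiffeologicalSpace X] (V : PseudoBundle.{u, v} X)

/-- The fibre of the dual pseudo-bundle: the diffeological dual of the fibre. -/
abbrev DualFib (x : X) : Type v := SmoothDual (V.Fib x)

/-- The value of a functional on a vector over the same base point. -/
def evalAt (φ : Σ x, V.DualFib x) (w : V.Total) (h : φ.1 = w.1) : ℝ :=
  φ.2.1 (V.castFib h.symm w.2)

/-- The plots `q` of the dual total space: `π* ∘ q` is a plot of the base, and for every plot `p` of
`V` the evaluation `(s, t) ↦ q(s)(p(t))` is smooth for the subset diffeology of its domain. -/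
def IsDualPlot {n : ℕ} (q : Euc n → Σ x, V.DualFib x) : Prop :=
  IsPlot (fun s => (q s).1) ∧
  ∀ (m : ℕ) (p : Euc m → V.Total), IsPlot p →
    DSmooth (fun z : {z : Euc n × Euc m // (q z.1).1 = (p z.2).1} =>
      V.evalAt (q z.1.1) (p z.1.2) z.2)

variable {V}

/-- Diagonal form of the condition on plots of the dual. -/
theorem isDualPlot_iff {n : ℕ} {q : Euc n → Σ x, V.DualFib x} :
    V.IsDualPlot q ↔ IsPlot (fun s => (q s).1) ∧
      ∀ (k : ℕ) (a : Euc k → Euc n) (p : Euc k → V.Total), ContDiff ℝ ∞ a → IsPlot p →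
        ∀ h : ∀ t, (q (a t)).1 = (p t).1,
          ContDiff ℝ ∞ (fun t => V.evalAt (q (a t)) (p t) (h t)) := by
  refine and_congr_right fun _ => ⟨fun H k a p ha hp h => ?_, fun H m p hp => ?_⟩
  · have := H k p hp k (fun t => ⟨(a t, t), h t⟩)
      (isPlot_prod.2 ⟨ha.isPlot, isPlot_id⟩)
    exact this.contDiff
  · intro k c hc
    obtain ⟨h1, h2⟩ := isPlot_prod.1 (isPlot_subtype.1 hc)
    exact (H k (fun t => (c t).1.1) (fun t => p (c t).1.2) h1.contDiff
      (isPlot_reparam hp h2.contDiff) (fun t => (c t).2)).isPlot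

variable (V) in
/-- The diffeology of the dual pseudo-bundle. -/
@[reducible]
def dualDiffeology : DiffeologicalSpace (Σ x, V.DualFib x) where
  plots _ := {q | V.IsDualPlot q}
  constant_plots {n} φ := by
    refine isDualPlot_iff.2 ⟨isPlot_const, fun k a p _ hp h => ?_⟩
    refine (φ.2.2 k (fun t => V.castFib (h t).symm (p t).2) ?_).contDiff
    have : (fun t => (⟨φ.1, V.castFib (h t).symm (p t).2⟩ : V.Total)) = p := by
      have aux : ∀ (w : V.Total) (hw : φ.1 = w.1),
          (⟨φ.1, V.castFib hw.symm w.2⟩ : V.Total) = w := by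
        rintro ⟨x, w⟩ hw
        obtain rfl : φ.1 = x := hw
        rfl
      exact funext fun t => aux (p t) (h t)
    change IsPlot (fun t => (⟨φ.1, V.castFib (h t).symm (p t).2⟩ : V.Total))
    rw [this]; exact hp
  plot_reparam {n m q f} hq hf := by
    replace hq := isDualPlot_iff.1 hq
    exact isDualPlot_iff.2 ⟨isPlot_reparam hq.1 hf, fun k a p ha hp h => hq.2 k (f ∘ a) p (hf.comp ha) hp h⟩
  locality {n q} H := by
    refine isDualPlot_iff.2 ⟨DiffeologicalSpace.locality fun x => ?_, fun k a p ha hp h => ?_⟩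
    · obtain ⟨s, hs, hx, h'⟩ := H x
      exact ⟨s, hs, hx, fun hf hfs => (h' hf hfs).1⟩
    · rw [contDiff_iff_contDiffAt]
      intro t₀
      obtain ⟨s, hs, hx, h'⟩ := H (a t₀)
      obtain ⟨ρ, hρ, hρs, hρt⟩ := exists_localizer (hs.preimage ha.continuous) hx
      have := (isDualPlot_iff.1 (h' (f := a ∘ ρ) hρs (ha.comp hρ))).2 k id (p ∘ ρ) contDiff_id
        (isPlot_reparam hp hρ) (fun t => h (ρ t))
      refine this.contDiffAt.congr_of_eventuallyEq ?_
      filter_upwards [hρt] with t ht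
      simp only [comp_apply, id, ht]

variable (V) in
/-- The dual pseudo-bundle `V* = ⋃ₓ (π⁻¹(x))*`. -/
def dual : PseudoBundle.{u, v} X where
  Fib := V.DualFib
  diffeology := V.dualDiffeology
  isBundle :=
    letI := V.dualDiffeology
    have key : ∀ {n : ℕ} {q : Euc n → Σ x, V.DualFib x}, IsPlot q ↔ V.IsDualPlot q := Iff.rfl
    { smooth_proj := fun n q hq => (key.1 hq).1
      smooth_add := fun n q hq => by
        obtain ⟨h1, h2⟩ := isPlot_prod.1 hq
        have h1' := isDualPlot_iff.1 (key.1 h1)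
        have h2' := isDualPlot_iff.1 (key.1 h2)
        exact key.2 (isDualPlot_iff.2 ⟨h1'.1, fun k a p ha hp h =>
          (h1'.2 k a p ha hp h).add (h2'.2 k a p ha hp h)⟩)
      smooth_smul := fun n q hq => by
        obtain ⟨h1, h2⟩ := isPlot_prod.1 hq
        have h2' := isDualPlot_iff.1 (key.1 h2)
        exact key.2 (isDualPlot_iff.2 ⟨h2'.1, fun k a p ha hp h =>
          (h1.contDiff.comp ha).mul (h2'.2 k a p ha hp h)⟩)
      smooth_zero := fun n r hr =>
        key.2 (isDualPlot_iff.2 ⟨hr, fun k a p _ _ _ => contDiff_const (c := (0 : ℝ))⟩) }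

end Dual

/-! ### Tensor products and pseudo-metrics -/

section Tensor

variable {X : Type u} [DiffeologicalSpace X] (V W : PseudoBundle.{u, v} X)

/-- The diffeologies on `⋃ₓ Vₓ ⊗ Wₓ` which make it a pseudo-bundle and for which the fibrewise map
`⊗ : V ×_X W → V ⊗ W` is smooth. -/
def tensorDiffeologies : Set (DiffeologicalSpace (Σ x, V.Fib x ⊗[ℝ] W.Fib x)) :=
  {d | IsBundleDiffeology (fun x => V.Fib x ⊗[ℝ] W.Fib x) d ∧
    @DSmooth (Σ x, V.Fib x × W.Fib x) (Σ x, V.Fib x ⊗[ℝ] W.Fib x)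
      (induced (fun z => ((⟨z.1, z.2.1⟩, ⟨z.1, z.2.2⟩) : V.Total × W.Total)) inferInstance) d
      (fun z => ⟨z.1, z.2.1 ⊗ₜ z.2.2⟩)}

/-- The tensor product pseudo-bundle: it carries the finest pseudo-bundle diffeology for which the
fibrewise map `⊗` is smooth. -/
def tensor : PseudoBundle.{u, v} X where
  Fib x := V.Fib x ⊗[ℝ] W.Fib x
  diffeology := sInf (V.tensorDiffeologies W)
  isBundle :=
    { smooth_proj := fun n p hp => by
        have h0 : induced Sigma.fst inferInstance ∈ V.tensorDiffeologies W := by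
          refine ⟨⟨fun n p hp => hp, fun n p hp => ?_, fun n p hp => ?_, fun n p hp => hp⟩,
            fun n p hp => ?_⟩
          · let : DiffeologicalSpace (Σ x, V.Fib x ⊗[ℝ] W.Fib x) :=
              induced Sigma.fst inferInstance
            exact (isPlot_prod.1 hp).1
          · let : DiffeologicalSpace (Σ x, V.Fib x ⊗[ℝ] W.Fib x) :=
              induced Sigma.fst inferInstance
            exact (isPlot_prod.1 hp).2
          · exact V.isBundle.smooth_proj n _ (isPlot_prod.1 hp).1
        exact DiffeologicalSpace.isPlot_sInf_iff.1 hp _ h0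
      smooth_add := fun n p hp => DiffeologicalSpace.isPlot_sInf_iff.2 fun d hd => by
        let := sInf (V.tensorDiffeologies W)
        obtain ⟨h1, h2⟩ := isPlot_prod.1 hp
        refine hd.1.smooth_add n p ?_
        let := d
        exact isPlot_prod.2 ⟨DiffeologicalSpace.isPlot_sInf_iff.1 h1 d hd,
          DiffeologicalSpace.isPlot_sInf_iff.1 h2 d hd⟩
      smooth_smul := fun n p hp => DiffeologicalSpace.isPlot_sInf_iff.2 fun d hd => by
        let := sInf (V.tensorDiffeologies W)
        obtain ⟨h1, h2⟩ := isPlot_prod.1 hp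
        refine hd.1.smooth_smul n p ?_
        let := d
        exact isPlot_prod.2 ⟨h1, DiffeologicalSpace.isPlot_sInf_iff.1 h2 d hd⟩
      smooth_zero := fun n p hp => DiffeologicalSpace.isPlot_sInf_iff.2 fun d hd =>
        hd.1.smooth_zero n p hp }

/-- The value `t(v, w)` of an element `t` of `(π⁻¹(x))* ⊗ (π⁻¹(x))*`, viewed as a bilinear form. -/
noncomputable def tensorEval {x : X} (t : (V.dual.tensor V.dual).Fib x) (v w : V.Fib x) : ℝ :=
  LinearMap.mul' ℝ ℝ
    (TensorProduct.map (LinearMap.applyₗ v ∘ₗ (SmoothDual (V.Fib x)).subtype)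
      (LinearMap.applyₗ w ∘ₗ (SmoothDual (V.Fib x)).subtype) t)

/-- A family of bilinear forms on the fibres. -/
abbrev Forms : Type (max u v) := ∀ x, LinearMap.BilinForm ℝ (V.Fib x)

/-- A pseudo-metric: a smooth section of `V* ⊗ V*` which is a pseudo-metric on each fibre. -/
structure IsPseudoMetric (g : V.Forms) : Prop where
  fib : ∀ x, IsVectorPseudoMetric (g x)
  smooth : ∃ σ : ∀ x, (V.dual.tensor V.dual).Fib x,
    DSmooth (fun x => (⟨x, σ x⟩ : (V.dual.tensor V.dual).Total)) ∧
      ∀ x v w, g x v w = V.tensorEval (σ x) v w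

/-- The induced pseudo-metric `g*` on the dual pseudo-bundle, determined by
`g*(x)(g(x)(v, ·), g(x)(w, ·)) = g(x)(v, w)`. -/
noncomputable def dualMetric {V : PseudoBundle.{u, v} X} {g : V.Forms} (hV : V.FiniteDim)
    (hg : V.IsPseudoMetric g) : V.dual.Forms :=
  fun x => haveI := hV x; (hg.fib x).dualForm

end Tensor

end PseudoBundle

/-! ## Gluing of diffeological spaces -/

section Glue

variable {X₁ : Type u₁} {X₂ : Type u₂} {Y : Set X₁}

/-- The set `X₁ ∪_f X₂`, as the disjoint union of `X₁ ∖ Y` and `X₂`; the two summands are the ranges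
of `i₁` and `i₂`. That it is the quotient `(X₁ ⊔ X₂)/∼` is `Glue.mk_surjective`, `Glue.mk_eq_iff`. -/
def Glue (_f : Y → X₂) : Type (max u₁ u₂) := ↥Yᶜ ⊕ X₂

namespace Glue

variable (f : Y → X₂)

/-- The inclusion `i₁ : X₁ ∖ Y → X₁ ∪_f X₂`. -/
def i₁ (x : ↥Yᶜ) : Glue f := Sum.inl x

/-- The inclusion `i₂ : X₂ → X₁ ∪_f X₂`. -/
def i₂ (x : X₂) : Glue f := Sum.inr x

open Classical in
/-- The quotient projection `X₁ ⊔ X₂ → X₁ ∪_f X₂`. -/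
noncomputable def mk : X₁ ⊕ X₂ → Glue f
  | Sum.inl x => if h : x ∈ Y then i₂ f (f ⟨x, h⟩) else i₁ f ⟨x, h⟩
  | Sum.inr x => i₂ f x

theorem mk_inl_of_mem (y : Y) : mk f (Sum.inl y) = i₂ f (f y) := by simp [mk]

theorem mk_inl_of_notMem (x : ↥Yᶜ) : mk f (Sum.inl x) = i₁ f x := dif_neg x.2

theorem mk_surjective : Surjective (mk f) := by
  rintro (x | x)
  · exact ⟨Sum.inl x, mk_inl_of_notMem f x⟩
  · exact ⟨Sum.inr x, rfl⟩

/-- The relation `y ∼ f(y)` for `y ∈ Y`. -/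
inductive Rel : X₁ ⊕ X₂ → X₁ ⊕ X₂ → Prop
  | glue (y : Y) : Rel (Sum.inl y) (Sum.inr (f y))

/-- Two points have the same image iff they are identified by the equivalence relation generated by
`y ∼ f(y)`. -/
theorem mk_eq_iff (a b : X₁ ⊕ X₂) : mk f a = mk f b ↔ Relation.EqvGen (Rel f) a b := by
  classical
  let rep : Glue f → X₁ ⊕ X₂ := Sum.map Subtype.val id
  have hrep : ∀ a, Relation.EqvGen (Rel f) a (rep (mk f a)) := by
    rintro (x | x)
    · by_cases h : x ∈ Y
      · rw [mk_inl_of_mem f ⟨x, h⟩]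
        exact .rel _ _ (Rel.glue (f := f) ⟨x, h⟩)
      · rw [mk_inl_of_notMem f ⟨x, h⟩]; exact .refl _
    · exact .refl _
  constructor
  · intro h
    have h1 := hrep a
    rw [h] at h1
    exact h1.trans _ _ _ (hrep b).symm
  · intro h
    induction h with
    | rel a b h => obtain ⟨y⟩ := h; exact mk_inl_of_mem f y
    | refl a => rfl
    | symm a b _ ih => exact ih.symm
    | trans a b c _ _ ih1 ih2 => exact ih1.trans ih2

/-- The gluing diffeology: the pushforward of the disjoint union diffeology. -/
noncomputable instance [DiffeologicalSpace X₁] [DiffeologicalSpace X₂] :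
    DiffeologicalSpace (Glue f) := coinduced (mk f) (mk_surjective f)

theorem isPlot_iff [DiffeologicalSpace X₁] [DiffeologicalSpace X₂] {n : ℕ} {p : Euc n → Glue f} :
    IsPlot p ↔ ∀ t₀,
      (∃ q : Euc n → X₁, IsPlot q ∧ p =ᶠ[𝓝 t₀] fun t => mk f (Sum.inl (q t))) ∨
      ∃ q : Euc n → X₂, IsPlot q ∧ p =ᶠ[𝓝 t₀] fun t => mk f (Sum.inr (q t)) :=
  isPlot_coinduced_sum (hf := mk_surjective f)

/-- The inverse `f⁻¹ : f(Y) → X₁` of an injective gluing map. -/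
noncomputable def inv (hf : Injective f) (z : Set.range f) : X₁ := (Equiv.ofInjective f hf).symm z

theorem inv_injective (hf : Injective f) : Injective (inv f hf) :=
  Subtype.val_injective.comp (Equiv.ofInjective f hf).symm.injective

theorem mk_inl_injective (hf : Injective f) : Injective fun x => mk f (Sum.inl x) := by
  intro x x' h
  by_cases hx : x ∈ Y <;> by_cases hx' : x' ∈ Y
  · simp only [mk, hx, hx', dite_true] at h
    exact congrArg Subtype.val (hf (Sum.inr_injective h))
  · simp only [mk, hx, hx', dite_true, dite_false] at h; cases h
  · simp only [mk, hx, hx', dite_true, dite_false] at h; cases h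
  · simp only [mk, hx, hx', dite_false] at h
    exact congrArg Subtype.val (Sum.inl_injective h)

theorem mem_of_mk_eq {x : X₁} {z : X₂} (h : mk f (Sum.inl x) = mk f (Sum.inr z)) : x ∈ Y := by
  by_contra hx
  simp only [mk, hx, dite_false] at h; cases h

open Classical in
/-- The switch map `X₁ ∪_f X₂ → X₂ ∪_{f⁻¹} X₁`. -/
noncomputable def switch (hf : Injective f) : Glue f → Glue (inv f hf)
  | Sum.inl x => i₂ (inv f hf) x
  | Sum.inr x => if h : x ∈ Set.range f then i₂ (inv f hf) (inv f hf ⟨x, h⟩)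
      else i₁ (inv f hf) ⟨x, h⟩

end Glue

end Glue

/-! ## Gluing of pseudo-bundles -/

section PseudoBundleGluing

variable {X₁ : Type u₁} {X₂ : Type u₂} [DiffeologicalSpace X₁] [DiffeologicalSpace X₂]

/-- A pair of maps `(f̃, f)` defining a gluing of `V₁` to `V₂`: a smooth map `f : Y → X₂` on a subset
`Y` of `X₁` and a smooth lift `f̃ : π₁⁻¹(Y) → V₂` of `f` that is linear on each fibre. -/
structure Gluing (V₁ : PseudoBundle.{u₁, v} X₁) (V₂ : PseudoBundle.{u₂, v} X₂) where
  Y : Set X₁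
  f : Y → X₂
  smooth_f : DSmooth f
  lift : ∀ y : Y, V₁.Fib y →ₗ[ℝ] V₂.Fib (f y)
  smooth_lift : DSmooth (fun w : {w : V₁.Total // w.1 ∈ Y} =>
    (⟨f ⟨w.1.1, w.2⟩, lift ⟨w.1.1, w.2⟩ w.1.2⟩ : V₂.Total))

namespace Gluing

variable {V₁ : PseudoBundle.{u₁, v} X₁} {V₂ : PseudoBundle.{u₂, v} X₂} (G : Gluing V₁ V₂)

/-- `f` is invertible with smooth inverse, that is, a diffeomorphism with its image. -/
structure Invertible : Prop where
  injective : Injective G.f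
  smooth_inv : DSmooth (Glue.inv G.f injective)

/-- Compatibility of families of forms (in particular, of pseudo-metrics) with the gluing:
`g₁(y)(v, w) = g₂(f(y))(f̃(v), f̃(w))`. -/
def Compatible (g₁ : V₁.Forms) (g₂ : V₂.Forms) : Prop :=
  ∀ (y : G.Y) (v w : V₁.Fib y), g₁ y v w = g₂ (G.f y) (G.lift y v) (G.lift y w)

theorem smooth_lift_fib (y : G.Y) : DSmooth (G.lift y) := fun n p hp =>
  G.smooth_lift n (fun t => ⟨⟨y, p t⟩, y.2⟩) hp

/-! ### The glued pseudo-bundle -/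

/-- The fibres of `V₁ ∪_f̃ V₂`: those of `V₁` over `i₁(X₁ ∖ Y)`, those of `V₂` over `i₂(X₂)`. -/
def GlueFib : Glue G.f → Type v
  | Sum.inl x => V₁.Fib x
  | Sum.inr x => V₂.Fib x

instance : ∀ c, AddCommGroup (G.GlueFib c)
  | Sum.inl x => inferInstanceAs (AddCommGroup (V₁.Fib x))
  | Sum.inr x => inferInstanceAs (AddCommGroup (V₂.Fib x))

instance : ∀ c, Module ℝ (G.GlueFib c)
  | Sum.inl x => inferInstanceAs (Module ℝ (V₁.Fib x))
  | Sum.inr x => inferInstanceAs (Module ℝ (V₂.Fib x))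

/-- The inclusion `j₁ : V₁ ∖ π₁⁻¹(Y) → V₁ ∪_f̃ V₂` on a fibre. -/
def j₁Fib (x : ↥G.Yᶜ) : V₁.Fib x →ₗ[ℝ] G.GlueFib (Glue.i₁ G.f x) :=
  (LinearMap.id : V₁.Fib x →ₗ[ℝ] V₁.Fib x)

/-- The inclusion `j₂ : V₂ → V₁ ∪_f̃ V₂` on a fibre. -/
def j₂Fib (x : X₂) : V₂.Fib x →ₗ[ℝ] G.GlueFib (Glue.i₂ G.f x) :=
  (LinearMap.id : V₂.Fib x →ₗ[ℝ] V₂.Fib x)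

open Classical in
/-- The quotient projection `V₁ ⊔ V₂ → V₁ ∪_f̃ V₂`, identifying `w ∈ π₁⁻¹(Y)` with `f̃(w)`. -/
noncomputable def totalMk : V₁.Total ⊕ V₂.Total → Σ c, G.GlueFib c
  | Sum.inl w =>
      if h : w.1 ∈ G.Y then ⟨Glue.i₂ G.f (G.f ⟨w.1, h⟩), G.j₂Fib _ (G.lift ⟨w.1, h⟩ w.2)⟩
      else ⟨Glue.i₁ G.f ⟨w.1, h⟩, G.j₁Fib ⟨w.1, h⟩ w.2⟩
  | Sum.inr w => ⟨Glue.i₂ G.f w.1, G.j₂Fib _ w.2⟩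

theorem totalMk_inl_of_mem (w : V₁.Total) (h : w.1 ∈ G.Y) :
    G.totalMk (Sum.inl w) = ⟨Glue.i₂ G.f (G.f ⟨w.1, h⟩), G.j₂Fib _ (G.lift ⟨w.1, h⟩ w.2)⟩ :=
  dif_pos h

theorem totalMk_inl_of_notMem (w : V₁.Total) (h : w.1 ∉ G.Y) :
    G.totalMk (Sum.inl w) = ⟨Glue.i₁ G.f ⟨w.1, h⟩, G.j₁Fib ⟨w.1, h⟩ w.2⟩ :=
  dif_neg h

theorem totalMk_surjective : Surjective G.totalMk := by
  rintro ⟨x | x, w⟩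
  · exact ⟨Sum.inl ⟨x, w⟩, G.totalMk_inl_of_notMem ⟨x, w⟩ x.2⟩
  · exact ⟨Sum.inr ⟨x, w⟩, rfl⟩

/-- The gluing diffeology on the total space. -/
@[reducible]
noncomputable def totalDiffeology : DiffeologicalSpace (Σ c, G.GlueFib c) :=
  coinduced G.totalMk G.totalMk_surjective

theorem totalMk_fst : ∀ z : V₁.Total ⊕ V₂.Total,
    (G.totalMk z).1 = Glue.mk G.f (Sum.map Sigma.fst Sigma.fst z)
  | Sum.inl w => by
      by_cases h : w.1 ∈ G.Y
      · rw [totalMk_inl_of_mem _ _ h]; exact (Glue.mk_inl_of_mem G.f ⟨w.1, h⟩).symm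
      · rw [totalMk_inl_of_notMem _ _ h]; exact (Glue.mk_inl_of_notMem G.f ⟨w.1, h⟩).symm
  | Sum.inr _ => rfl

open PseudoBundle (sigmaAdd sigmaAdd_congr isPlot_sigmaAdd)

theorem sigmaAdd_totalMk_inl (w w' : V₁.Total) (h : w.1 = w'.1)
    (h' : (G.totalMk (Sum.inl w)).1 = (G.totalMk (Sum.inl w')).1) :
    sigmaAdd (G.totalMk (Sum.inl w)) (G.totalMk (Sum.inl w')) h' =
      G.totalMk (Sum.inl (sigmaAdd w w' h)) := by
  obtain ⟨x, w⟩ := w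
  obtain ⟨x', w'⟩ := w'
  obtain rfl : x = x' := h
  by_cases hx : x ∈ G.Y
  · refine (sigmaAdd_congr (G.totalMk_inl_of_mem _ hx) (G.totalMk_inl_of_mem _ hx) h' rfl).trans ?_
    rw [G.totalMk_inl_of_mem _ (show (sigmaAdd (E := V₁.Fib) ⟨x, w⟩ ⟨x, w'⟩ rfl).1 ∈ G.Y from hx)]
    exact Sigma.ext rfl (heq_of_eq ((map_add (G.j₂Fib _) _ _).symm.trans
      (congrArg (G.j₂Fib _) (map_add (G.lift ⟨x, hx⟩) w w').symm)))
  · refine (sigmaAdd_congr (G.totalMk_inl_of_notMem _ hx) (G.totalMk_inl_of_notMem _ hx) h'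
      rfl).trans ?_
    rw [G.totalMk_inl_of_notMem _
      (show (sigmaAdd (E := V₁.Fib) ⟨x, w⟩ ⟨x, w'⟩ rfl).1 ∉ G.Y from hx)]
    exact Sigma.ext rfl (heq_of_eq (map_add (G.j₁Fib ⟨x, hx⟩) w w').symm)

theorem sigmaAdd_totalMk_inr (w w' : V₂.Total) (h : w.1 = w'.1)
    (h' : (G.totalMk (Sum.inr w)).1 = (G.totalMk (Sum.inr w')).1) :
    sigmaAdd (G.totalMk (Sum.inr w)) (G.totalMk (Sum.inr w')) h' =
      G.totalMk (Sum.inr (sigmaAdd w w' h)) := by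
  obtain ⟨x, w⟩ := w
  obtain ⟨x', w'⟩ := w'
  obtain rfl : x = x' := h
  rfl

theorem smul_totalMk : ∀ (c : ℝ) (z : V₁.Total ⊕ V₂.Total),
    (⟨(G.totalMk z).1, c • (G.totalMk z).2⟩ : Σ c, G.GlueFib c) =
      G.totalMk (Sum.map (fun w => ⟨w.1, c • w.2⟩) (fun w => ⟨w.1, c • w.2⟩) z)
  | c, Sum.inl w => by
      by_cases h : w.1 ∈ G.Y
      · rw [Sum.map_inl, G.totalMk_inl_of_mem w h, G.totalMk_inl_of_mem ⟨w.1, c • w.2⟩ h]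
        simp
      · rw [Sum.map_inl, G.totalMk_inl_of_notMem w h, G.totalMk_inl_of_notMem ⟨w.1, c • w.2⟩ h]
        simp
  | _, Sum.inr _ => rfl

theorem zero_mk : ∀ z : X₁ ⊕ X₂,
    (⟨Glue.mk G.f z, 0⟩ : Σ c, G.GlueFib c) =
      G.totalMk (Sum.map (fun x => ⟨x, 0⟩) (fun x => ⟨x, 0⟩) z)
  | Sum.inl x => by
      by_cases h : x ∈ G.Y
      · rw [Sum.map_inl, G.totalMk_inl_of_mem ⟨x, 0⟩ h, Glue.mk_inl_of_mem G.f ⟨x, h⟩]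
        simp
      · rw [Sum.map_inl, G.totalMk_inl_of_notMem ⟨x, 0⟩ h, Glue.mk_inl_of_notMem G.f ⟨x, h⟩]
        simp
  | Sum.inr _ => rfl

/-- A plot of `V₁` which stays over `Y` near a point is there identified with a plot of `V₂`. -/
theorem exists_lift_right {n : ℕ} {q : Euc n → V₁.Total} (hq : IsPlot q) {t₀ : Euc n}
    (h : ∀ᶠ t in 𝓝 t₀, (q t).1 ∈ G.Y) : ∃ r : Euc n → V₂.Total, IsPlot r ∧
      ∀ᶠ t in 𝓝 t₀, G.totalMk (Sum.inl (q t)) = G.totalMk (Sum.inr (r t)) := by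
  obtain ⟨s, hs, hso, hts⟩ := eventually_nhds_iff.1 h
  obtain ⟨ρ, hρ, hρs, hρt⟩ := exists_localizer hso hts
  refine ⟨_, G.smooth_lift n (fun t => ⟨q (ρ t), hs _ (hρs t)⟩) (isPlot_reparam hq hρ), ?_⟩
  filter_upwards [hρt] with t ht
  calc G.totalMk (Sum.inl (q t)) = G.totalMk (Sum.inl (q (ρ t))) := by rw [ht]
    _ = _ := G.totalMk_inl_of_mem _ (hs _ (hρs t))

theorem isPlot_total {n : ℕ} {p : Euc n → Σ c, G.GlueFib c} :
    @IsPlot _ G.totalDiffeology n p ↔ ∀ t₀,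
      (∃ q : Euc n → V₁.Total, IsPlot q ∧ p =ᶠ[𝓝 t₀] fun t => G.totalMk (Sum.inl (q t))) ∨
      ∃ q : Euc n → V₂.Total, IsPlot q ∧ p =ᶠ[𝓝 t₀] fun t => G.totalMk (Sum.inr (q t)) :=
  isPlot_coinduced_sum

theorem isBundle_glue (hf : Injective G.f) : IsBundleDiffeology G.GlueFib G.totalDiffeology where
  smooth_proj n p hp := (Glue.isPlot_iff G.f).2 fun t₀ => by
    rcases G.isPlot_total.1 hp t₀ with ⟨q, hq, he⟩ | ⟨q, hq, he⟩
    · refine Or.inl ⟨_, V₁.isBundle.smooth_proj n q hq, ?_⟩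
      filter_upwards [he] with t ht
      rw [comp_apply, ht, totalMk_fst]; rfl
    · refine Or.inr ⟨_, V₂.isBundle.smooth_proj n q hq, ?_⟩
      filter_upwards [he] with t ht
      rw [comp_apply, ht, totalMk_fst]; rfl
  smooth_add n p hp := by
    let _ := G.totalDiffeology
    obtain ⟨h1, h2⟩ := isPlot_prod.1 hp
    -- the case of two local lifts to `V₁`
    have key₁ : ∀ (t₀ : Euc n) (q q' : Euc n → V₁.Total), IsPlot q → IsPlot q' →
        (∀ᶠ t in 𝓝 t₀, (⟨(p t).1, (p t).2.1⟩ : Σ c, G.GlueFib c) = G.totalMk (Sum.inl (q t))) →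
        (∀ᶠ t in 𝓝 t₀, (⟨(p t).1, (p t).2.2⟩ : Σ c, G.GlueFib c) = G.totalMk (Sum.inl (q' t))) →
        ∃ r : Euc n → V₁.Total, IsPlot r ∧ ∀ᶠ t in 𝓝 t₀,
          (⟨(p t).1, (p t).2.1 + (p t).2.2⟩ : Σ c, G.GlueFib c) = G.totalMk (Sum.inl (r t)) := by
      intro t₀ q q' hq hq' he he'
      obtain ⟨s, hs, hso, hts⟩ := eventually_nhds_iff.1 (he.and he')
      obtain ⟨ρ, hρ, hρs, hρt⟩ := exists_localizer hso hts
      have hb : ∀ t, (q (ρ t)).1 = (q' (ρ t)).1 := fun t => by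
        have e1 := congrArg Sigma.fst (hs _ (hρs t)).1
        have e2 := congrArg Sigma.fst (hs _ (hρs t)).2
        rw [totalMk_fst] at e1 e2
        exact Glue.mk_inl_injective G.f hf (e1.symm.trans e2)
      refine ⟨_, isPlot_sigmaAdd (isPlot_reparam hq hρ) (isPlot_reparam hq' hρ) hb, ?_⟩
      filter_upwards [hρt] with t ht
      have a := hs _ (hρs t)
      refine Eq.trans ?_ (G.sigmaAdd_totalMk_inl (q (ρ t)) (q' (ρ t)) (hb t)
        (by rw [← a.1, ← a.2]))
      rw [← sigmaAdd_congr a.1 a.2 rfl, ht]; rfl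
    have key₂ : ∀ (t₀ : Euc n) (q q' : Euc n → V₂.Total), IsPlot q → IsPlot q' →
        (∀ᶠ t in 𝓝 t₀, (⟨(p t).1, (p t).2.1⟩ : Σ c, G.GlueFib c) = G.totalMk (Sum.inr (q t))) →
        (∀ᶠ t in 𝓝 t₀, (⟨(p t).1, (p t).2.2⟩ : Σ c, G.GlueFib c) = G.totalMk (Sum.inr (q' t))) →
        ∃ r : Euc n → V₂.Total, IsPlot r ∧ ∀ᶠ t in 𝓝 t₀,
          (⟨(p t).1, (p t).2.1 + (p t).2.2⟩ : Σ c, G.GlueFib c) = G.totalMk (Sum.inr (r t)) := by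
      intro t₀ q q' hq hq' he he'
      obtain ⟨s, hs, hso, hts⟩ := eventually_nhds_iff.1 (he.and he')
      obtain ⟨ρ, hρ, hρs, hρt⟩ := exists_localizer hso hts
      have hb : ∀ t, (q (ρ t)).1 = (q' (ρ t)).1 := fun t => by
        have e1 := congrArg Sigma.fst (hs _ (hρs t)).1
        have e2 := congrArg Sigma.fst (hs _ (hρs t)).2
        rw [totalMk_fst] at e1 e2
        exact Sum.inr_injective (e1.symm.trans e2)
      refine ⟨_, isPlot_sigmaAdd (isPlot_reparam hq hρ) (isPlot_reparam hq' hρ) hb, ?_⟩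
      filter_upwards [hρt] with t ht
      have a := hs _ (hρs t)
      refine Eq.trans ?_ (G.sigmaAdd_totalMk_inr (q (ρ t)) (q' (ρ t)) (hb t)
        (by rw [← a.1, ← a.2]))
      rw [← sigmaAdd_congr a.1 a.2 rfl, ht]; rfl
    refine G.isPlot_total.2 fun t₀ => ?_
    rcases G.isPlot_total.1 h1 t₀ with ⟨q, hq, he⟩ | ⟨q, hq, he⟩ <;>
      rcases G.isPlot_total.1 h2 t₀ with ⟨q', hq', he'⟩ | ⟨q', hq', he'⟩
    · exact Or.inl (key₁ t₀ q q' hq hq' he he')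
    · obtain ⟨r, hr, her⟩ := G.exists_lift_right hq (t₀ := t₀) (by
        filter_upwards [he, he'] with t ht ht'
        have e1 := congrArg Sigma.fst ht
        have e2 := congrArg Sigma.fst ht'
        rw [totalMk_fst] at e1 e2
        exact Glue.mem_of_mk_eq G.f (e1.symm.trans e2))
      exact Or.inr (key₂ t₀ r q' hr hq' (by filter_upwards [he, her] with t a b using a.trans b)
        he')
    · obtain ⟨r, hr, her⟩ := G.exists_lift_right hq' (t₀ := t₀) (by
        filter_upwards [he, he'] with t ht ht'
        have e1 := congrArg Sigma.fst ht
        have e2 := congrArg Sigma.fst ht'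
        rw [totalMk_fst] at e1 e2
        exact Glue.mem_of_mk_eq G.f (e2.symm.trans e1))
      exact Or.inr (key₂ t₀ q r hq hr he
        (by filter_upwards [he', her] with t a b using a.trans b))
    · exact Or.inr (key₂ t₀ q q' hq hq' he he')
  smooth_smul n p hp := by
    let _ := G.totalDiffeology
    obtain ⟨h1, h2⟩ := isPlot_prod.1 hp
    refine G.isPlot_total.2 fun t₀ => ?_
    rcases G.isPlot_total.1 h2 t₀ with ⟨q, hq, he⟩ | ⟨q, hq, he⟩
    · refine Or.inl ⟨_, V₁.isBundle.smooth_smul n (fun t => ((p t).1, q t))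
        (isPlot_prod.2 ⟨h1, hq⟩), ?_⟩
      filter_upwards [he] with t ht
      simp only [comp_apply]
      rw [ht]
      exact G.smul_totalMk _ _
    · refine Or.inr ⟨_, V₂.isBundle.smooth_smul n (fun t => ((p t).1, q t))
        (isPlot_prod.2 ⟨h1, hq⟩), ?_⟩
      filter_upwards [he] with t ht
      simp only [comp_apply]
      rw [ht]
      exact G.smul_totalMk _ _
  smooth_zero n p hp := by
    let _ := G.totalDiffeology
    refine G.isPlot_total.2 fun t₀ => ?_
    rcases (Glue.isPlot_iff G.f).1 hp t₀ with ⟨q, hq, he⟩ | ⟨q, hq, he⟩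
    · refine Or.inl ⟨_, V₁.isBundle.smooth_zero n q hq, ?_⟩
      filter_upwards [he] with t ht
      simp only [comp_apply]
      rw [ht]
      exact G.zero_mk _
    · refine Or.inr ⟨_, V₂.isBundle.smooth_zero n q hq, ?_⟩
      filter_upwards [he] with t ht
      simp only [comp_apply]
      rw [ht]
      exact G.zero_mk _

/-- The glued pseudo-bundle `π₁ ∪_(f̃,f) π₂ : V₁ ∪_f̃ V₂ → X₁ ∪_f X₂`, for injective `f`. -/
noncomputable def glue (hf : Injective G.f) : PseudoBundle.{max u₁ u₂, v} (Glue G.f) where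
  Fib := G.GlueFib
  diffeology := G.totalDiffeology
  isBundle := G.isBundle_glue hf

theorem smooth_j₁Fib (hf : Injective G.f) (x : ↥G.Yᶜ) :
    @DSmooth (V₁.Fib x) ((G.glue hf).Fib (Glue.i₁ G.f x)) _ _ (G.j₁Fib x) := fun _ p hp =>
  G.isPlot_total.2 fun _ => Or.inl ⟨fun t => ⟨x, p t⟩, hp,
    Eventually.of_forall fun _ => (G.totalMk_inl_of_notMem ⟨x, _⟩ x.2).symm⟩

theorem smooth_j₂Fib (hf : Injective G.f) (x : X₂) :
    @DSmooth (V₂.Fib x) ((G.glue hf).Fib (Glue.i₂ G.f x)) _ _ (G.j₂Fib x) := fun _ p hp =>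
  G.isPlot_total.2 fun _ => Or.inr ⟨fun t => ⟨x, p t⟩, hp, EventuallyEq.rfl⟩

/-- `(j₁)*`, on the fibre of `(V₁ ∪_f̃ V₂)*` over `i₁(x)`. -/
noncomputable def j₁Dual (hf : Injective G.f) (x : ↥G.Yᶜ) :
    (G.glue hf).DualFib (Glue.i₁ G.f x) →ₗ[ℝ] V₁.DualFib x :=
  SmoothDual.comap (W := (G.glue hf).Fib (Glue.i₁ G.f x)) (G.j₁Fib x) (G.smooth_j₁Fib hf x)

/-- `(j₂)*`, on the fibre of `(V₁ ∪_f̃ V₂)*` over `i₂(x)`. -/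
noncomputable def j₂Dual (hf : Injective G.f) (x : X₂) :
    (G.glue hf).DualFib (Glue.i₂ G.f x) →ₗ[ℝ] V₂.DualFib x :=
  SmoothDual.comap (W := (G.glue hf).Fib (Glue.i₂ G.f x)) (G.j₂Fib x) (G.smooth_j₂Fib hf x)

/-! ### The dual gluing and the commutativity condition -/

/-- The dual map `f̃*` on a fibre: `φ ↦ φ ∘ f̃`. -/
def liftDual (y : G.Y) : V₂.DualFib (G.f y) →ₗ[ℝ] V₁.DualFib y :=
  SmoothDual.comap (G.lift y) (G.smooth_lift_fib y)

/-- The point of `Y` corresponding to a point of `f(Y)`. -/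
noncomputable def pre (hf : Injective G.f) (z : Set.range G.f) : G.Y :=
  (Equiv.ofInjective G.f hf).symm z

theorem f_pre (hf : Injective G.f) (z : Set.range G.f) : (z : X₂) = G.f (G.pre hf z) :=
  (congrArg Subtype.val ((Equiv.ofInjective G.f hf).apply_symm_apply z)).symm

theorem evalAt_liftDual (y : G.Y) (x : X₂) (hx : x = G.f y) (φ : V₂.dual.Fib x) (w : V₁.Total)
    (h : (y : X₁) = w.1) (hw : w.1 ∈ G.Y) (h' : x = G.f ⟨w.1, hw⟩) :
    V₁.evalAt ⟨y, G.liftDual y (V₂.dual.castFib hx φ)⟩ w h =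
      V₂.evalAt ⟨x, φ⟩ ⟨G.f ⟨w.1, hw⟩, G.lift ⟨w.1, hw⟩ w.2⟩ h' := by
  obtain ⟨y, hy⟩ := y
  obtain ⟨x', w⟩ := w
  obtain rfl : y = x' := h
  subst hx
  rfl

/-- The gluing of `V₂*` to `V₁*` along `(f̃*, f⁻¹)`. -/
noncomputable def dual (hG : G.Invertible) : Gluing V₂.dual V₁.dual where
  Y := Set.range G.f
  f := Glue.inv G.f hG.injective
  smooth_f := hG.smooth_inv
  lift z := G.liftDual (G.pre hG.injective z) ∘ₗ
    (V₂.dual.castFib (G.f_pre hG.injective z)).toLinearMap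
  smooth_lift := fun n q hq => by
    have hq' : V₂.IsDualPlot fun t => (q t).1 := hq
    refine PseudoBundle.isDualPlot_iff.2 ⟨hG.smooth_inv n (fun t => ⟨(q t).1.1, (q t).2⟩) hq'.1,
      fun k a p ha hp h => ?_⟩
    have hp1 : ∀ t, (p t).1 ∈ G.Y := fun t => by
      rw [← h t]; exact (G.pre hG.injective ⟨(q (a t)).1.1, (q (a t)).2⟩).2
    have hp2 : ∀ t, (q (a t)).1.1 = G.f ⟨(p t).1, hp1 t⟩ := fun t =>
      (G.f_pre hG.injective ⟨(q (a t)).1.1, (q (a t)).2⟩).trans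
        (congrArg G.f (Subtype.ext (h t)))
    have := (PseudoBundle.isDualPlot_iff.1 hq').2 k a _ ha
      (G.smooth_lift k (fun t => ⟨p t, hp1 t⟩) hp) hp2
    refine (congrArg (ContDiff ℝ ∞) (funext fun t => ?_)).mpr this
    exact G.evalAt_liftDual (G.pre hG.injective ⟨(q (a t)).1.1, (q (a t)).2⟩) _ _ _ _ (h t)
      (hp1 t) (hp2 t)

/-- The gluing-dual commutativity condition: there is a diffeomorphism
`Φ : (V₁ ∪_f̃ V₂)* → V₂* ∪_f̃* V₁*` covering the switch map and given by `j₂ ∘ (j₁)*` over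
`i₁(X₁ ∖ Y)`, by `j₂ ∘ f̃* ∘ (j₂)*` over `i₂(f(Y))`, and by `j₁ ∘ (j₂)*` over `i₂(X₂ ∖ f(Y))`. -/
def DualCommutes (hG : G.Invertible) : Prop :=
  ∃ Φ : (G.glue hG.injective).dual.Total ≃
      ((G.dual hG).glue (Glue.inv_injective G.f hG.injective)).Total,
    DSmooth Φ ∧ DSmooth Φ.symm ∧
    (∀ φ, (Φ φ).1 = Glue.switch G.f hG.injective φ.1) ∧
    (∀ (x : ↥G.Yᶜ) (φ : (G.glue hG.injective).DualFib (Glue.i₁ G.f x)),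
      Φ ⟨Glue.i₁ G.f x, φ⟩ =
        ⟨Glue.i₂ (G.dual hG).f x, (G.dual hG).j₂Fib x (G.j₁Dual hG.injective x φ)⟩) ∧
    (∀ (y : G.Y) (φ : (G.glue hG.injective).DualFib (Glue.i₂ G.f (G.f y))),
      Φ ⟨Glue.i₂ G.f (G.f y), φ⟩ =
        ⟨Glue.i₂ (G.dual hG).f y,
          (G.dual hG).j₂Fib y (G.liftDual y (G.j₂Dual hG.injective (G.f y) φ))⟩) ∧
    (∀ (x : ↥(Set.range G.f)ᶜ) (φ : (G.glue hG.injective).DualFib (Glue.i₂ G.f x)),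
      Φ ⟨Glue.i₂ G.f x, φ⟩ =
        ⟨Glue.i₁ (G.dual hG).f x, (G.dual hG).j₁Fib x (G.j₂Dual hG.injective x φ)⟩)

end Gluing

end PseudoBundleGluing

/-! The claim is a statement about one fibre at a time. Fix `y ∈ Y` and write `L : V → W` for the
map `f̃` on the fibre over `y`, with forms `b₁ = L^*b₂`. In terms of the pairing maps `P₁ : V → V*`
and `P₂ : W → W*`, compatibility reads `L* ∘ P₂ ∘ L = P₁`. The rank condition on a pseudo-metric
makes `P₁` surjective onto the smooth dual. If moreover `L*` is injective, then for `φ ∈ W*` one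
writes `L*φ = P₁ v = L*(P₂(L v))` and cancels `L*`: every functional on `W` is represented by a
vector in the range of `L`. With `φ = P₂(L v)` and `ψ = P₂(L w)`, both sides of the claim equal
`b₁(v, w)`. This is `dualForm_comap`.

Injectivity of `L*` does not follow from compatibility: for `V = 0` and `W = ℝ` with its standard
metric, the forms are compatible but their duals are not. It comes from the commutativity condition
(`liftDual_injective`). Over `i₂(f(y))` the bijection `Φ` is `j₂ ∘ f̃* ∘ (j₂)*`, so `f̃*` is
injective on the image of `(j₂)*`. That image is the whole dual fibre (`j₂Dual_surjective`), because
gluing adds no plots to a fibre of `V₂`: a plot coming from `V₁` that stays in such a fibre is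
carried into `V₂` by the smooth map `f̃`. -/

/-! ### Linear algebra on a single fibre. -/

theorem IsVectorPseudoMetric.pairing_surjective {V : Type*} [AddCommGroup V] [Module ℝ V]
    [DiffeologicalSpace V] [FiniteDimensional ℝ V] {b : LinearMap.BilinForm ℝ V}
    (hb : IsVectorPseudoMetric b) : Surjective hb.pairing := fun φ => by
  obtain ⟨s, hs⟩ := hb.exists_section
  exact ⟨s φ, LinearMap.congr_fun hs φ⟩

/-- If a smooth linear map `L` pulls `b₂` back to `b₁` and its dual map is injective, then the dual
map pulls `b₁*` back to `b₂*`. -/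
theorem IsVectorPseudoMetric.dualForm_comap {V W : Type*} [AddCommGroup V] [Module ℝ V]
    [DiffeologicalSpace V] [FiniteDimensional ℝ V] [AddCommGroup W] [Module ℝ W]
    [DiffeologicalSpace W] [FiniteDimensional ℝ W]
    {b₁ : LinearMap.BilinForm ℝ V} {b₂ : LinearMap.BilinForm ℝ W}
    (hb₁ : IsVectorPseudoMetric b₁) (hb₂ : IsVectorPseudoMetric b₂)
    (L : V →ₗ[ℝ] W) (hL : DSmooth L) (hb : ∀ v w, b₁ v w = b₂ (L v) (L w))
    (hinj : Injective (SmoothDual.comap L hL)) (φ ψ : SmoothDual W) :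
    hb₂.dualForm φ ψ =
      hb₁.dualForm (SmoothDual.comap L hL φ) (SmoothDual.comap L hL ψ) := by
  -- The hypothesis `hb`, read as an equality of functionals in its second argument.
  have key : ∀ v, SmoothDual.comap L hL (hb₂.pairing (L v)) = hb₁.pairing v := fun v =>
    Subtype.ext (LinearMap.ext fun w => (hb v w).symm)
  -- Surjectivity of the pairing on `V` represents the pullback of `φ` by some `v`. By `key`, `φ`
  -- and the functional of `L v` have the same pullback, so `hinj` identifies them.
  have lift : ∀ φ : SmoothDual W, ∃ v, hb₂.pairing (L v) = φ := fun φ => by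
    obtain ⟨v, hv⟩ := hb₁.pairing_surjective (SmoothDual.comap L hL φ)
    exact ⟨v, hinj ((key v).trans hv)⟩
  obtain ⟨v, rfl⟩ := lift φ
  obtain ⟨w, rfl⟩ := lift ψ
  rw [key, key, dualForm_pairing, dualForm_pairing, hb]

/-! ### Fibres of the glued bundle and injectivity of the dual lift. -/

section

variable {X₁ : Type u₁} {X₂ : Type u₂} [DiffeologicalSpace X₁] [DiffeologicalSpace X₂]
  {V₁ : PseudoBundle.{u₁, v} X₁} {V₂ : PseudoBundle.{u₂, v} X₂}

namespace Gluing

variable (G : Gluing V₁ V₂)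

/-- Every point of `V₂` is its own representative in the gluing, even where `f̃` is not injective.
This lets an equality in the glued space be read back in `V₂`. -/
theorem totalMk_inr_injective : Injective fun w => G.totalMk (Sum.inr w) := by
  rintro ⟨x, w⟩ ⟨x', w'⟩ h
  obtain rfl : x = x' := Sum.inr_injective (congrArg Sigma.fst h)
  exact Sigma.ext rfl (heq_of_eq (eq_of_heq (Sigma.mk.inj h).2))

/-- The inclusion `j₂` does not coarsen the diffeology of the fibres of `V₂`: the inverse of its
restriction to a fibre maps plots to maps that are locally plots. -/
theorem exists_localizer_isPlot_j₂Fib_symm (hf : Injective G.f) (x : X₂) {n : ℕ}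
    {p : Euc n → (G.glue hf).Fib (Glue.i₂ G.f x)} (hp : IsPlot p) (t₀ : Euc n) :
    ∃ ρ : Euc n → Euc n, (∀ᶠ t in 𝓝 t₀, ρ t = t) ∧
      @IsPlot (V₂.Fib x) _ n (fun t => p (ρ t)) := by
  have hlift : ∃ r : Euc n → V₂.Total, IsPlot r ∧ ∀ᶠ t in 𝓝 t₀,
      (⟨Glue.i₂ G.f x, p t⟩ : Σ c, G.GlueFib c) = G.totalMk (Sum.inr (r t)) := by
    rcases G.isPlot_total.1 hp t₀ with ⟨q, hq, he⟩ | ⟨q, hq, he⟩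
    -- A local lift to `V₁` has base points identified with `x ∈ X₂`, hence lies over `Y`, and `f̃`
    -- turns it into a lift to `V₂`.
    · obtain ⟨r, hr, her⟩ := G.exists_lift_right hq (t₀ := t₀) (by
        filter_upwards [he] with t ht
        have e := congrArg Sigma.fst ht
        rw [totalMk_fst] at e
        exact Glue.mem_of_mk_eq G.f (z := x) e.symm)
      exact ⟨r, hr, by filter_upwards [he, her] with t a b using a.trans b⟩
    · exact ⟨q, hq, he⟩
  obtain ⟨r, hr, her⟩ := hlift
  -- The lift `r` is controlled only near `t₀` and may leave the fibre over `x` elsewhere.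
  -- Precomposing with `ρ`, whose values stay in `s`, makes the equality hold everywhere.
  obtain ⟨s, hs, hso, hts⟩ := eventually_nhds_iff.1 her
  obtain ⟨ρ, hρ, hρs, hρt⟩ := exists_localizer hso hts
  refine ⟨ρ, hρt, ?_⟩
  have : (fun t => (⟨x, p (ρ t)⟩ : V₂.Total)) = r ∘ ρ :=
    funext fun t => G.totalMk_inr_injective (hs _ (hρs t))
  change IsPlot (fun t => (⟨x, p (ρ t)⟩ : V₂.Total))
  rw [this]
  exact isPlot_reparam hr hρ

/-- Smooth functionals on a fibre of `V₂` are smooth on the corresponding fibre of `V₁ ∪_f̃ V₂`. -/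
theorem j₂Dual_surjective (hf : Injective G.f) (x : X₂) : Surjective (G.j₂Dual hf x) := by
  intro φ
  -- On underlying vector spaces `j₂` is the identity, so the preimage is `φ` itself. What remains
  -- is its smoothness along plots of the glued fibre, which is checked locally.
  refine ⟨⟨(φ.1 : V₂.Fib x →ₗ[ℝ] ℝ), fun n p hp => ContDiff.isPlot ?_⟩, rfl⟩
  rw [contDiff_iff_contDiffAt]
  intro t₀
  obtain ⟨ρ, hρ, hpρ⟩ := G.exists_localizer_isPlot_j₂Fib_symm hf x hp t₀
  refine (φ.2 n _ hpρ).contDiff.contDiffAt.congr_of_eventuallyEq ?_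
  filter_upwards [hρ] with t ht
  exact congrArg (fun s => φ.1 (p s)) ht.symm

/-- Under the gluing-dual commutativity condition `f̃*` is injective on each fibre. -/
theorem DualCommutes.liftDual_injective {G : Gluing V₁ V₂} {hG : G.Invertible}
    (h : G.DualCommutes hG) (y : G.Y) : Injective (G.liftDual y) := by
  obtain ⟨Φ, -, -, -, -, hΦ, -⟩ := h
  intro φ ψ hφψ
  -- Both functionals are extended to the glued fibre, where `Φ` is defined. Its formula over
  -- `i₂(f(Y))` depends on them only through `f̃* ∘ (j₂)*`, so `Φ` takes the same value on both.
  obtain ⟨φ, rfl⟩ := G.j₂Dual_surjective hG.injective _ φ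
  obtain ⟨ψ, rfl⟩ := G.j₂Dual_surjective hG.injective _ ψ
  have hΦy := hΦ y φ
  rw [hφψ] at hΦy
  have := Φ.injective (hΦy.trans (hΦ y ψ).symm)
  rw [eq_of_heq (Sigma.mk.inj this).2]

end Gluing

end

/-! ### Compatibility of the induced pseudo-metrics. -/

theorem mainTheorem2 {X₁ : Type u₁} {X₂ : Type u₂} [DiffeologicalSpace X₁] [DiffeologicalSpace X₂]
    (V₁ : PseudoBundle.{u₁, v} X₁) (V₂ : PseudoBundle.{u₂, v} X₂)
    (hfd₁ : V₁.FiniteDim) (hfd₂ : V₂.FiniteDim)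
    (hlt₁ : V₁.LocallyTrivial) (hlt₂ : V₂.LocallyTrivial)
    (G : Gluing V₁ V₂) (hG : G.Invertible)
    (g₁ : V₁.Forms) (g₂ : V₂.Forms) (hg₁ : V₁.IsPseudoMetric g₁) (hg₂ : V₂.IsPseudoMetric g₂)
    (hcompat : G.Compatible g₁ g₂) (hcomm : G.DualCommutes hG) :
    (G.dual hG).Compatible (PseudoBundle.dualMetric hfd₂ hg₂)
      (PseudoBundle.dualMetric hfd₁ hg₁) := by

  -- A point `z` of `f(Y)` equals `f(f⁻¹(z))` only propositionally, so the dual lift contains a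
  -- transport between fibres. With `x` a free variable the equation can be eliminated, and the
  -- transport becomes the identity.
  have key : ∀ (y : G.Y) (x : X₂) (hx : x = G.f y) (φ ψ : V₂.dual.Fib x),
      PseudoBundle.dualMetric hfd₂ hg₂ x φ ψ = PseudoBundle.dualMetric hfd₁ hg₁ y
        (G.liftDual y (V₂.dual.castFib hx φ)) (G.liftDual y (V₂.dual.castFib hx ψ)) := by
    rintro y _ rfl φ ψ
    have := hfd₁ y
    have := hfd₂ (G.f y)
    exact (hg₁.fib y).dualForm_comap (hg₂.fib (G.f y)) (G.lift y) (G.smooth_lift_fib y)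
      (hcompat y) (hcomm.liftDual_injective y) φ ψ
  exact fun z => key (G.pre hG.injective z) z (G.f_pre hG.injective z)
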